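/- Let $d\ge 0$, let $I$ be a finite set, and let $(M_i)_{i\in I}$ be smooth $d$-dimensional manifolds (Hausdorff, second countable, without boundary). Let open subsets $M_{ij}\subseteq M_i$ and smooth maps $f_{ij}:M_{ij}\to M_j$ $(i,j\in I)$ be given such that for all $i,j,k\in I$: 1. $M_{ii}=M_i$ and $f_{ii}=\mathrm{id}_{M_i}$; 2. $f_{ij}(M_{ij})=M_{ji}$ and $f_{ij}^{-1}=f_{ji}$; 3. for every $x\in M_{ij}\cap M_{ik}$ one has $f_{ij}(x)\in M_{jk}$ and $f_{jk}(f_{ij}(x))=f_{ik}(x)$. Let $\mathbf M=\bigl(\bigsqcup_{i\in I}M_i\bigr)/\!\sim$, where $(x,i)\sim(y,j)$ if and only if $x\in M_{ij}$ and $f_{ij}(x)=y$, with the quotient topology; write $\phi_i:M_i\to\mathbf M$, $\phi_i(x)=[x,i]$, for the canonical open embeddings. Give $\mathbf M$ (a possibly non-Hausdorff manifold) the smooth structure whose atlas consists of the charts $(\phi_i(U),\varphi\circ\phi_i^{-1})$ with $i\in I$ and $(U,\varphi)$ a chart of $M_i$. Then the unital $\mathbb R$-algebra $C^\infty(\mathbf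 M)$ of smooth real-valued functions is isomorphic to the fibred product $$\prod_{\mathcal F}C^\infty(M_i):=\Bigl\{(r_i)_{i\in I}\in\prod_{i\in I}C^\infty(M_i)\ \Big|\ r_i=r_j\circ f_{ij}\text{ on }M_{ij}\text{ for all }i,j\in I\Bigr\},$$ a subalgebra of the product algebra; more precisely, the map $\mathbf r\mapsto(\mathbf r\circ\phi_i)_{i\in I}$ is an isomorphism of unital $\mathbb R$-algebras from $C^\infty(\mathbf M)$ onto $\prod_{\mathcal F}C^\infty(M_i)$. -/

import Mathlib

open Set Topology
open scoped Manifold ContDiff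

universe u v

/-- A smooth adjunction system on a family `M i` of `d`-dimensional smooth manifolds: open gluing
regions `A i j ⊆ M i` and smooth gluing maps `f i j : A i j → M j` such that
* `A i i = M i` and `f i i = id`,
* `f i j` has image `A j i`, and `f j i` is its inverse,
* on `A i j ∩ A i k` the composite `f j k ∘ f i j` is defined and equals `f i k`. -/
structure AdjunctionSystem (d : ℕ) {I : Type u} (M : I → Type v)
    [∀ i, TopologicalSpace (M i)] [∀ i, ChartedSpace (EuclideanSpace ℝ (Fin d)) (M i)] where
  /-- the gluing regions -/
  A : ∀ i _j : I, TopologicalSpace.Opens (M i)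
  /-- the gluing maps -/
  f : ∀ i j : I, A i j → M j
  smooth : ∀ i j, ContMDiff (𝓡 d) (𝓡 d) ∞ (f i j)
  A_self : ∀ i, A i i = ⊤
  f_self : ∀ i (x : A i i), f i i x = x
  range_f : ∀ i j, range (f i j) = A j i
  f_inv : ∀ i j (x : A i j) (h : f i j x ∈ A j i), f j i ⟨f i j x, h⟩ = x
  cocycle_mem : ∀ i j k (x : M i) (hj : x ∈ A i j), x ∈ A i k → f i j ⟨x, hj⟩ ∈ A j k
  cocycle : ∀ i j k (x : M i) (hj : x ∈ A i j) (hk : x ∈ A i k) (h : f i j ⟨x, hj⟩ ∈ A j k),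
    f j k ⟨f i j ⟨x, hj⟩, h⟩ = f i k ⟨x, hk⟩

namespace AdjunctionSystem

variable {d : ℕ} {I : Type u} {M : I → Type v} [∀ i, TopologicalSpace (M i)]
  [∀ i, ChartedSpace (EuclideanSpace ℝ (Fin d)) (M i)] (F : AdjunctionSystem d M)

lemma f_mem (i j : I) (x : F.A i j) : F.f i j x ∈ F.A j i := by
  have h : F.f i j x ∈ range (F.f i j) := ⟨x, rfl⟩
  rwa [F.range_f] at h

/-- The relation `(x, i) ~ (y, j)` if and only if `x ∈ A i j` and `f i j x = y`. -/
def Rel (p q : Σ i, M i) : Prop :=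
  ∃ h : p.2 ∈ F.A p.1 q.1, F.f p.1 q.1 ⟨p.2, h⟩ = q.2

lemma rel_equivalence : Equivalence F.Rel where
  refl := by
    rintro ⟨i, x⟩
    exact ⟨by simp [F.A_self], F.f_self i _⟩
  symm := by
    rintro ⟨i, x⟩ ⟨j, y⟩ ⟨h, e⟩
    dsimp only at h e
    subst e
    exact ⟨F.f_mem i j _, F.f_inv i j _ _⟩
  trans := by
    rintro ⟨i, x⟩ ⟨j, y⟩ ⟨k, z⟩ ⟨h, e⟩ ⟨h', e'⟩
    dsimp only at h e h' e'
    subst e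
    subst e'
    have hx : F.f j i ⟨F.f i j ⟨x, h⟩, F.f_mem i j _⟩ = x := F.f_inv i j _ _
    have hk : x ∈ F.A i k := by
      have := F.cocycle_mem j i k _ (F.f_mem i j ⟨x, h⟩) h'
      rwa [hx] at this
    exact ⟨hk, (F.cocycle i j k x h hk h').symm⟩

/-- The equivalence relation of the gluing. -/
def setoid : Setoid (Σ i, M i) := ⟨F.Rel, F.rel_equivalence⟩

/-- The adjunction space: the disjoint union of the `M i` modulo the gluing relation, with the
quotient topology. -/
def Space : Type (max u v) := Quotient F.setoid

instance : TopologicalSpace F.Space :=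
  inferInstanceAs (TopologicalSpace (Quotient F.setoid))

/-- The canonical map `x ↦ [x, i]` from `M i` to the adjunction space. -/
def ι (i : I) (x : M i) : F.Space := Quotient.mk F.setoid ⟨i, x⟩

lemma ι_eq_iff {i j : I} {x : M i} {y : M j} :
    F.ι i x = F.ι j y ↔ ∃ h : x ∈ F.A i j, F.f i j ⟨x, h⟩ = y :=
  Quotient.eq (r := F.setoid)

lemma ι_f (i j : I) (x : F.A i j) : F.ι j (F.f i j x) = F.ι i x :=
  (F.ι_eq_iff.2 ⟨x.2, rfl⟩).symm

lemma continuous_ι (i : I) : Continuous (F.ι i) :=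
  (continuous_quotient_mk' (s := F.setoid)).comp continuous_sigmaMk

lemma isOpenEmbedding_ι (i : I) : IsOpenEmbedding (F.ι i) := by
  refine .of_continuous_injective_isOpenMap (F.continuous_ι i) ?_ ?_
  · intro x y h
    obtain ⟨hx, e⟩ := F.ι_eq_iff.1 h
    rw [← e, F.f_self]
  · intro U hU
    change IsOpen (Quotient.mk F.setoid ⁻¹' (F.ι i '' U))
    rw [isOpen_sigma_iff]
    intro j
    have : Sigma.mk j ⁻¹' (Quotient.mk F.setoid ⁻¹' (F.ι i '' U))
        = Subtype.val '' (F.f j i ⁻¹' U) := by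
      ext y
      constructor
      · rintro ⟨x, hx, e⟩
        obtain ⟨h, e'⟩ := F.ι_eq_iff.1 (e.symm : F.ι j y = F.ι i x)
        exact ⟨⟨y, h⟩, by rw [mem_preimage, e']; exact hx, rfl⟩
      · rintro ⟨⟨y, h⟩, hy, rfl⟩
        exact ⟨_, hy, F.ι_f j i ⟨y, h⟩⟩
    rw [this]
    exact (F.A j i).isOpen.isOpenMap_subtype_val _ (hU.preimage (F.smooth j i).continuous)

lemma ι_out (p : F.Space) :
    F.ι (Quotient.out (s := F.setoid) p).1 (Quotient.out (s := F.setoid) p).2 = p :=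
  Quotient.out_eq (s := F.setoid) p

/-- The atlas of the adjunction space: the charts `(ι i (U), φ ∘ (ι i)⁻¹)`, for `(U, φ)` a chart
in the atlas of some `M i`. -/
noncomputable instance : ChartedSpace (EuclideanSpace ℝ (Fin d)) F.Space where
  atlas := ⋃ i, (fun φ => φ.lift_openEmbedding (F.isOpenEmbedding_ι i)) ''
    atlas (EuclideanSpace ℝ (Fin d)) (M i)
  chartAt p :=
    (chartAt (EuclideanSpace ℝ (Fin d)) (Quotient.out (s := F.setoid) p).2).lift_openEmbedding
      (F.isOpenEmbedding_ι _)
  mem_chart_source p := ⟨_, mem_chart_source _ _, F.ι_out p⟩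
  chart_mem_atlas _ := mem_iUnion.2 ⟨_, _, chart_mem_atlas _ _, rfl⟩

/-- The transition maps of this atlas are smooth. -/
instance [∀ i, IsManifold (𝓡 d) ∞ (M i)] : IsManifold (𝓡 d) ∞ F.Space := by
  refine isManifold_of_contDiffOn _ _ _ ?_
  intro e e' he he'
  obtain ⟨i, φ, hφ, rfl⟩ := mem_iUnion.1 he
  obtain ⟨j, ψ, hψ, rfl⟩ := mem_iUnion.1 he'
  rintro z ⟨⟨hz, hz'⟩, -⟩
  obtain ⟨y, hy, hyz⟩ := hz'
  change z ∈ φ.target at hz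
  change F.ι j y = F.ι i (φ.symm z) at hyz
  obtain ⟨hA, hf⟩ := F.ι_eq_iff.1 hyz.symm
  have hφz : φ.symm z ∈ φ.source := φ.map_target hz
  have key : ContMDiffAt (𝓡 d) (𝓡 d) ∞
      (fun x : M i => (ψ.lift_openEmbedding (F.isOpenEmbedding_ι j)) (F.ι i x)) (φ.symm z) := by
    have h1 : ContMDiffAt (𝓡 d) (𝓡 d) ∞ (ψ ∘ F.f i j) ⟨φ.symm z, hA⟩ := by
      refine ContMDiffAt.comp _ ?_ (F.smooth i j _)
      exact contMDiffAt_of_mem_maximalAtlas (IsManifold.subset_maximalAtlas hψ) (hf ▸ hy)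
    have h2 : (ψ ∘ F.f i j) = fun x : F.A i j =>
        (ψ.lift_openEmbedding (F.isOpenEmbedding_ι j)) (F.ι i x) := by
      funext x
      rw [← F.ι_f i j x, OpenPartialHomeomorph.lift_openEmbedding_apply, Function.comp]
    rw [h2] at h1
    exact (contMDiffAt_subtype_iff (U := F.A i j) (x := ⟨φ.symm z, hA⟩) (f := fun x : M i =>
      (ψ.lift_openEmbedding (F.isOpenEmbedding_ι j)) (F.ι i x))).1 h1
  have h3 : ContMDiffAt (𝓡 d) (𝓡 d) ∞ φ.symm z :=
    (contMDiffOn_symm_of_mem_maximalAtlas (IsManifold.subset_maximalAtlas hφ)).contMDiffAt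
      (φ.open_target.mem_nhds hz)
  exact (contMDiffAt_iff_contDiffAt.1 (key.comp z h3)).contDiffWithinAt

/-- The fibred product of the algebras `C^∞(M i)`: the subalgebra of the product consisting of the
tuples `r` with `r i = r j ∘ f i j` on `A i j` for all `i`, `j`. -/
def fibredProduct : Subalgebra ℝ (∀ i, C^∞⟮𝓡 d, M i; ℝ⟯) where
  carrier := {r | ∀ i j (x : F.A i j), r i x = r j (F.f i j x)}
  mul_mem' {r s} hr hs i j x := by
    change r i x * s i x = r j _ * s j _
    rw [hr, hs]
  add_mem' {r s} hr hs i j x := by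
    change r i x + s i x = r j _ + s j _
    rw [hr, hs]
  algebraMap_mem' _ _ _ _ := rfl

end AdjunctionSystem

namespace AdjunctionSystem

variable {d : ℕ} {I : Type u} {M : I → Type v} [∀ i, TopologicalSpace (M i)]
  [∀ i, ChartedSpace (EuclideanSpace ℝ (Fin d)) (M i)] (F : AdjunctionSystem d M)

/-! A function on the quotient is the same as a family of functions on the pieces that agree along
the gluing maps, so only smoothness needs an argument. Each `F.ι i` is an open embedding and the
lifted charts make it a local diffeomorphism: read in a chart of `M i` and its lift, it is the
identity. Hence smoothness passes from the quotient to the pieces (`contMDiff_ι`) and, as the images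
of the `F.ι i` form an open cover, back again (`contMDiff_of_comp_ι`). -/

lemma lift_chart_mem_maximalAtlas [∀ i, IsManifold (𝓡 d) ∞ (M i)] (i : I) (x : M i) :
    (chartAt (EuclideanSpace ℝ (Fin d)) x).lift_openEmbedding (F.isOpenEmbedding_ι i) ∈
      IsManifold.maximalAtlas (𝓡 d) ∞ F.Space :=
  IsManifold.subset_maximalAtlas (mem_iUnion.2 ⟨i, _, chart_mem_atlas _ x, rfl⟩)

/-- The canonical maps into the adjunction space are smooth. -/
lemma contMDiff_ι [∀ i, IsManifold (𝓡 d) ∞ (M i)] (i : I) :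
    ContMDiff (𝓡 d) (𝓡 d) ∞ (F.ι i) := by
  intro x
  let φ := chartAt (EuclideanSpace ℝ (Fin d)) x
  let ψ := φ.lift_openEmbedding (F.isOpenEmbedding_ι i)
  have hx : x ∈ φ.source := mem_chart_source _ x
  have h1 : ContMDiffAt (𝓡 d) (𝓡 d) ∞ ψ.symm (φ x) :=
    (contMDiffOn_symm_of_mem_maximalAtlas (F.lift_chart_mem_maximalAtlas i x)).contMDiffAt
      (ψ.open_target.mem_nhds (φ.map_source hx))
  -- On `φ.source` the map `F.ι i` is `ψ.symm ∘ φ`, because `ψ.symm` is `F.ι i ∘ φ.symm`.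
  refine (h1.comp x (contMDiffAt_of_mem_maximalAtlas
    (IsManifold.chart_mem_maximalAtlas x) hx)).congr_of_eventuallyEq ?_
  filter_upwards [φ.open_source.mem_nhds hx] with y hy
  exact congrArg (F.ι i) (φ.left_inv hy).symm

/-- A function on the adjunction space is smooth if its restrictions to all pieces are. -/
lemma contMDiff_of_comp_ι [∀ i, IsManifold (𝓡 d) ∞ (M i)] {g : F.Space → ℝ}
    (hg : ∀ i, ContMDiff (𝓡 d) 𝓘(ℝ, ℝ) ∞ (g ∘ F.ι i)) : ContMDiff (𝓡 d) 𝓘(ℝ, ℝ) ∞ g := by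
  intro p
  obtain ⟨⟨i, x⟩, rfl⟩ := Quotient.exists_rep p
  change ContMDiffAt _ _ _ g (F.ι i x)
  let φ := chartAt (EuclideanSpace ℝ (Fin d)) x
  let ψ := φ.lift_openEmbedding (F.isOpenEmbedding_ι i)
  have hx : x ∈ φ.source := mem_chart_source _ x
  have hιx : F.ι i x ∈ ψ.source := ⟨x, hx, rfl⟩
  have h1 : ContMDiffAt (𝓡 d) (𝓡 d) ∞ ψ (F.ι i x) :=
    contMDiffAt_of_mem_maximalAtlas (F.lift_chart_mem_maximalAtlas i x) hιx
  have h2 : ContMDiffAt (𝓡 d) (𝓡 d) ∞ φ.symm (ψ (F.ι i x)) :=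
    (contMDiffOn_symm_of_mem_maximalAtlas (IsManifold.chart_mem_maximalAtlas x)).contMDiffAt
      (φ.open_target.mem_nhds (ψ.map_source hιx))
  -- `φ.symm ∘ ψ` is a smooth local inverse of `F.ι i`, so near `F.ι i x` the function `g` is `(g ∘
  -- F.ι i) ∘ φ.symm ∘ ψ`.
  refine ((hg i _).comp (F.ι i x) (h2.comp (F.ι i x) h1)).congr_of_eventuallyEq ?_
  filter_upwards [ψ.open_source.mem_nhds hιx] with q hq
  exact congrArg g (ψ.left_inv hq).symm

/-- The restriction of smooth functions on the adjunction space to the pieces. -/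
noncomputable def restrict [∀ i, IsManifold (𝓡 d) ∞ (M i)] :
    C^∞⟮𝓡 d, F.Space; ℝ⟯ →ₐ[ℝ] F.fibredProduct where
  toFun r := ⟨fun i => ⟨r ∘ F.ι i, r.contMDiff.comp (F.contMDiff_ι i)⟩,
    fun i j x => congrArg r (F.ι_f i j x).symm⟩
  map_one' := rfl
  map_mul' _ _ := rfl
  map_zero' := rfl
  map_add' _ _ := rfl
  commutes' _ := rfl

lemma restrict_apply [∀ i, IsManifold (𝓡 d) ∞ (M i)] (r : C^∞⟮𝓡 d, F.Space; ℝ⟯)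
    (i : I) (x : M i) : (F.restrict r : ∀ i, C^∞⟮𝓡 d, M i; ℝ⟯) i x = r (F.ι i x) :=
  rfl

/-- The images of the `F.ι i` cover the adjunction space. -/
lemma restrict_injective [∀ i, IsManifold (𝓡 d) ∞ (M i)] :
    Function.Injective F.restrict := by
  intro r s h
  ext p
  obtain ⟨⟨i, x⟩, rfl⟩ := Quotient.exists_rep p
  change r (F.ι i x) = s (F.ι i x)
  rw [← restrict_apply, h, restrict_apply]

lemma restrict_surjective [∀ i, IsManifold (𝓡 d) ∞ (M i)] :
    Function.Surjective F.restrict := by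
  rintro ⟨r, hr⟩
  -- The fibred product condition says exactly that the family is constant on equivalence classes.
  let g : F.Space → ℝ := Quotient.lift (s := F.setoid) (fun p => r p.1 p.2) <| by
    rintro ⟨i, x⟩ ⟨j, y⟩ ⟨h, e⟩
    exact (hr i j ⟨x, h⟩).trans (congrArg (r j) e)
  -- `g ∘ F.ι i` is `r i` by definition of the lift.
  exact ⟨⟨g, F.contMDiff_of_comp_ι fun i => (r i).contMDiff⟩, rfl⟩

end AdjunctionSystem

/-- For a finite smooth adjunction system, the restriction map `r ↦ (r ∘ ι i)ᵢ` is an isomorphism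
of `ℝ`-algebras from `C^∞` of the adjunction space onto the fibred product of the `C^∞(M i)`. -/
theorem mainTheorem3 {d : ℕ} {I : Type u} [Finite I] {M : I → Type v}
    [∀ i, TopologicalSpace (M i)] [∀ i, T2Space (M i)] [∀ i, SecondCountableTopology (M i)]
    [∀ i, ChartedSpace (EuclideanSpace ℝ (Fin d)) (M i)] [∀ i, IsManifold (𝓡 d) ∞ (M i)]
    (F : AdjunctionSystem d M) :
    ∃ Φ : C^∞⟮𝓡 d, F.Space; ℝ⟯ ≃ₐ[ℝ] F.fibredProduct,
      ∀ (r : C^∞⟮𝓡 d, F.Space; ℝ⟯) (i : I) (x : M i),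
        (Φ r : ∀ i, C^∞⟮𝓡 d, M i; ℝ⟯) i x = r (F.ι i x) :=
  ⟨.ofBijective F.restrict ⟨F.restrict_injective, F.restrict_surjective⟩, F.restrict_apply⟩
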